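/- Let $n\ge 0$ be an integer and let $K,H\le\mathbb H^\times$ be finite subgroups of the multiplicative group of the real quaternions with $[K,K]\le H\trianglelefteq K$ and $H\neq\{1\}$. Let $A_n(K,H)\le \mathrm{GL}_n(\mathbb H)$ be the group of diagonal matrices $\mathrm{diag}(k_1,\dots,k_n)$ with $k_1,\dots,k_n\in K$ and $k_1\cdots k_n\in H$, let $S_n$ be the group of $n\times n$ permutation matrices, and let $G=G_n(K,H)=A_n(K,H)\rtimes S_n$, acting from the left on the right $\mathbb H$-vector space $V=\mathbb H^n$ of column vectors. A parabolic subgroup of $G$ is the pointwise stabilizer in $G$ of a subset of $V$; let $\mathcal P(G)$ be the set of parabolic subgroups of $G$, ordered by inclusion. Let $\mathcal A(G)$ be the set of the fixed spaces $\mathrm{Fix}(g)=\ker(1-g)$ of the reflections $g\in G$ (the elements $g$ of finite order with $\operatorname{rk}(1-g)=1$), and let $L(\mathcal A(G))$ be the lattice of all intersections of members of $\mathcal A(G)$ (including the empty intersection $V$), ordered by reverse inclusion. Let $\mathcal D_n(K)$ be the Dowling lattice of rank $n$ of $K$. Its elements are represented by triples $(J,\Pi,\xi)$, where $J\subseteq\{1,\dots,n\}$,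 $\Pi$ is a partition of the set $J$ into nonempty blocks, and $\xi:J\to K$ is a function. One puts $(J,\Pi,\xi)\le(J',\Pi',\xi')$ if every block of $\Pi'$ is a union of blocks $B$ of $\Pi$ such that, for each of these $B$, there is $g\in K$ with $\xi'(l)=g\,\xi(l)$ for all $l\in B$. Two triples are identified if each is $\le$ the other, that is, if $J=J'$, $\Pi=\Pi'$ and for every block $B\in\Pi$ there is $g\in K$ with $\xi'(l)=g\,\xi(l)$ for all $l\in B$. Then: 1. the posets $\mathcal P(G_n(K,H))$ and $\mathcal D_n(K)$ are isomorphic; 2. there is an isomorphism of lattices $L(\mathcal A(G_n(K,H)))\cong\mathcal D_n(K)$. -/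

import Mathlib

namespace QuatRefl

noncomputable section

open scoped Quaternion

/-! ### Groups acting on right quaternionic vector spaces

A right vector space over the quaternions is a module over the opposite ring `ℍ[ℝ]ᵐᵒᵖ`. The group
`GL(V)` is the automorphism group `V ≃ₗ[ℍ[ℝ]ᵐᵒᵖ] V`, acting on `V` from the left. -/

section Arrangement

variable {V : Type*} [AddCommGroup V] [Module ℍ[ℝ]ᵐᵒᵖ V]

/-- The pointwise fixed space of `g`, the kernel of `1 - g`. -/
def fixedSpace (g : V ≃ₗ[ℍ[ℝ]ᵐᵒᵖ] V) : Submodule ℍ[ℝ]ᵐᵒᵖ V :=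
  LinearMap.ker (LinearMap.id - (g : V →ₗ[ℍ[ℝ]ᵐᵒᵖ] V))

/-- Quaternionic reflections: elements of finite order such that `1 - g` has rank one. -/
def IsReflection (g : V ≃ₗ[ℍ[ℝ]ᵐᵒᵖ] V) : Prop :=
  IsOfFinOrder g ∧
    Module.finrank ℍ[ℝ]ᵐᵒᵖ (LinearMap.range (LinearMap.id - (g : V →ₗ[ℍ[ℝ]ᵐᵒᵖ] V))) = 1

/-- The reflection arrangement of `G`: the fixed spaces of the reflections in `G`. -/
def reflectionArrangement (G : Subgroup (V ≃ₗ[ℍ[ℝ]ᵐᵒᵖ] V)) : Set (Submodule ℍ[ℝ]ᵐᵒᵖ V) :=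
  {X | ∃ g ∈ G, IsReflection g ∧ X = fixedSpace g}

/-- The intersection lattice of an arrangement: all intersections of members of `A` (the whole
space being the empty intersection), ordered by reverse inclusion. -/
@[ext]
structure IntersectionLattice (A : Set (Submodule ℍ[ℝ]ᵐᵒᵖ V)) where
  space : Submodule ℍ[ℝ]ᵐᵒᵖ V
  exists_eq_sInf : ∃ S ⊆ A, space = sInf S

instance (A : Set (Submodule ℍ[ℝ]ᵐᵒᵖ V)) : PartialOrder (IntersectionLattice A) where
  le X Y := Y.space ≤ X.space
  le_refl X := le_refl X.space
  le_trans X Y Z hXY hYZ := le_trans (a := Z.space) hYZ hXY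
  le_antisymm X Y hXY hYX := IntersectionLattice.ext (le_antisymm (a := X.space) hYX hXY)

/-- Joins are intersections; the meet of `X` and `Y` is the intersection of all members of `A`
that contain both. -/
instance (A : Set (Submodule ℍ[ℝ]ᵐᵒᵖ V)) : Lattice (IntersectionLattice A) where
  sup X Y := ⟨X.space ⊓ Y.space, by
    obtain ⟨S, hS, hX⟩ := X.exists_eq_sInf
    obtain ⟨T, hT, hY⟩ := Y.exists_eq_sInf
    exact ⟨S ∪ T, Set.union_subset hS hT, by rw [sInf_union, ← hX, ← hY]⟩⟩
  le_sup_left X Y := inf_le_left (a := X.space) (b := Y.space)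
  le_sup_right X Y := inf_le_right (a := X.space) (b := Y.space)
  sup_le X Y Z hX hY := by
    change Z.space ≤ X.space at hX
    change Z.space ≤ Y.space at hY
    exact (le_inf hX hY : Z.space ≤ X.space ⊓ Y.space)
  inf X Y := ⟨sInf {W | W ∈ A ∧ X.space ≤ W ∧ Y.space ≤ W},
    {W | W ∈ A ∧ X.space ≤ W ∧ Y.space ≤ W}, fun _ hW => hW.1, rfl⟩
  inf_le_left X Y := le_sInf (a := X.space) fun W hW => hW.2.1
  inf_le_right X Y := le_sInf (a := Y.space) fun W hW => hW.2.2
  le_inf X Y Z hX hY := by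
    obtain ⟨S, hS, hXS⟩ := X.exists_eq_sInf
    change sInf {W | W ∈ A ∧ Y.space ≤ W ∧ Z.space ≤ W} ≤ X.space
    change Y.space ≤ X.space at hX
    change Z.space ≤ X.space at hY
    rw [hXS] at hX hY ⊢
    exact le_sInf fun W hW =>
      sInf_le ⟨hS hW, hX.trans (sInf_le hW), hY.trans (sInf_le hW)⟩

/-- The poset of parabolic subgroups of `G`, i.e. of the pointwise stabilizers in `G` of subsets
of `V`, ordered by inclusion. -/
abbrev ParabolicSubgroup (G : Subgroup (V ≃ₗ[ℍ[ℝ]ᵐᵒᵖ] V)) : Type _ :=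
  {P : Subgroup G // ∃ S : Set V, P = fixingSubgroup G S}

end Arrangement

/-! ### The imprimitive groups `G_n(K, H)` -/

section Imprimitive

/-- The diagonal matrix `diag(d₁, …, dₙ)`, acting on column vectors. -/
def diag {n : ℕ} (d : Fin n → ℍ[ℝ]ˣ) : (Fin n → ℍ[ℝ]) ≃ₗ[ℍ[ℝ]ᵐᵒᵖ] (Fin n → ℍ[ℝ]) where
  toFun v i := d i * v i
  invFun v i := (d i)⁻¹ * v i
  map_add' v w := by
    funext i
    simp [mul_add]
  map_smul' c v := by
    funext i
    simp [mul_assoc]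
  left_inv v := by
    funext i
    simp
  right_inv v := by
    funext i
    simp

/-- The permutation matrix of `σ`, which sends the `j`-th unit vector to the `σ j`-th one. -/
def permMat {n : ℕ} (σ : Equiv.Perm (Fin n)) :
    (Fin n → ℍ[ℝ]) ≃ₗ[ℍ[ℝ]ᵐᵒᵖ] (Fin n → ℍ[ℝ]) where
  toFun v i := v (σ⁻¹ i)
  invFun v i := v (σ i)
  map_add' _ _ := rfl
  map_smul' _ _ := rfl
  left_inv v := by
    funext i
    simp
  right_inv v := by
    funext i
    simp

@[simp] theorem diag_apply {n : ℕ} (d : Fin n → ℍ[ℝ]ˣ) (v : Fin n → ℍ[ℝ]) (i : Fin n) :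
    diag d v i = d i * v i := rfl

@[simp] theorem permMat_apply {n : ℕ} (σ : Equiv.Perm (Fin n)) (v : Fin n → ℍ[ℝ]) (i : Fin n) :
    permMat σ v i = v (σ⁻¹ i) := rfl

theorem diag_mul {n : ℕ} (d e : Fin n → ℍ[ℝ]ˣ) : diag d * diag e = diag (d * e) := by
  refine LinearEquiv.ext fun v => funext fun i => ?_
  simp [mul_assoc]

theorem permMat_mul {n : ℕ} (σ τ : Equiv.Perm (Fin n)) :
    permMat σ * permMat τ = permMat (σ * τ) := by
  refine LinearEquiv.ext fun v => funext fun i => ?_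
  simp

theorem permMat_mul_diag {n : ℕ} (σ : Equiv.Perm (Fin n)) (d : Fin n → ℍ[ℝ]ˣ) :
    permMat σ * diag d = diag (fun i => d (σ⁻¹ i)) * permMat σ := by
  refine LinearEquiv.ext fun v => funext fun i => ?_
  simp

/-- Membership of an ordered product of elements of `K` in a subgroup `H ⊇ [K, K]` can be tested in
the abelianization of `K`. -/
theorem prod_mem_iff {K H : Subgroup ℍ[ℝ]ˣ} (hcomm : ⁅K, K⁆ ≤ H) {n : ℕ} (d : Fin n → K) :
    ((List.ofFn d).prod : ℍ[ℝ]ˣ) ∈ H ↔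
      ∏ i, Abelianization.of (d i) ∈ (H.subgroupOf K).map Abelianization.of := by
  have h1 : ∏ i, Abelianization.of (d i) = Abelianization.of (List.ofFn d).prod := by
    rw [map_list_prod, List.map_ofFn, List.prod_ofFn]
    rfl
  rw [h1]
  constructor
  · intro h
    exact ⟨_, h, rfl⟩
  · rintro ⟨k, hk, hkd⟩
    have h2 : k⁻¹ * (List.ofFn d).prod ∈ commutator K := by
      rw [← Abelianization.ker_of, MonoidHom.mem_ker, map_mul, map_inv, hkd, inv_mul_cancel]
    have h3 : ((k⁻¹ * (List.ofFn d).prod : K) : ℍ[ℝ]ˣ) ∈ ⁅K, K⁆ := by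
      have h4 := Subgroup.mem_map_of_mem K.subtype h2
      rwa [commutator_def, Subgroup.map_commutator, ← MonoidHom.range_eq_map,
        Subgroup.range_subtype] at h4
    have h5 := H.mul_mem (Subgroup.mem_subgroupOf.1 hk) (hcomm h3)
    simpa using h5

/-- The group `A_n(K, H)` of all `diag(k₁, …, kₙ)` with `kᵢ ∈ K` and `k₁ ⋯ kₙ ∈ H`, where
`[K, K] ≤ H`. -/
def diagGroup (n : ℕ) (K H : Subgroup ℍ[ℝ]ˣ) (hcomm : ⁅K, K⁆ ≤ H) :
    Subgroup ((Fin n → ℍ[ℝ]) ≃ₗ[ℍ[ℝ]ᵐᵒᵖ] (Fin n → ℍ[ℝ])) where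
  carrier := {g | ∃ d : Fin n → K, ((List.ofFn d).prod : ℍ[ℝ]ˣ) ∈ H ∧ g = diag fun i => (d i : ℍ[ℝ]ˣ)}
  one_mem' := by
    refine ⟨1, ?_, ?_⟩
    · rw [prod_mem_iff hcomm]
      simp
    · refine LinearEquiv.ext fun v => funext fun i => ?_
      simp
  mul_mem' := by
    rintro _ _ ⟨d, hd, rfl⟩ ⟨e, he, rfl⟩
    refine ⟨d * e, ?_, ?_⟩
    · rw [prod_mem_iff hcomm] at *
      simpa [Finset.prod_mul_distrib] using mul_mem hd he
    · rw [diag_mul]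
      rfl
  inv_mem' := by
    rintro _ ⟨d, hd, rfl⟩
    refine ⟨d⁻¹, ?_, ?_⟩
    · rw [prod_mem_iff hcomm] at *
      simpa using inv_mem hd
    · rw [inv_eq_iff_mul_eq_one, diag_mul]
      refine LinearEquiv.ext fun v => funext fun i => ?_
      simp

theorem permMat_conj_mem {n : ℕ} {K H : Subgroup ℍ[ℝ]ˣ} (hcomm : ⁅K, K⁆ ≤ H)
    (σ : Equiv.Perm (Fin n)) {a : (Fin n → ℍ[ℝ]) ≃ₗ[ℍ[ℝ]ᵐᵒᵖ] (Fin n → ℍ[ℝ])}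
    (ha : a ∈ diagGroup n K H hcomm) :
    ∃ b ∈ diagGroup n K H hcomm, permMat σ * a = b * permMat σ := by
  obtain ⟨d, hd, rfl⟩ := ha
  refine ⟨_, ⟨fun i => d (σ⁻¹ i), ?_, rfl⟩, permMat_mul_diag σ _⟩
  rw [prod_mem_iff hcomm] at *
  rwa [Equiv.prod_comp σ⁻¹ fun i => Abelianization.of (d i)]

/-- The group `G_n(K, H) = A_n(K, H) ⋊ S_n` of `n × n` quaternionic matrices, where
`[K, K] ≤ H`. -/
def imprimitiveGroup (n : ℕ) (K H : Subgroup ℍ[ℝ]ˣ) (hcomm : ⁅K, K⁆ ≤ H) :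
    Subgroup ((Fin n → ℍ[ℝ]) ≃ₗ[ℍ[ℝ]ᵐᵒᵖ] (Fin n → ℍ[ℝ])) where
  carrier := {g | ∃ a ∈ diagGroup n K H hcomm, ∃ σ : Equiv.Perm (Fin n), g = a * permMat σ}
  one_mem' := by
    refine ⟨1, one_mem _, 1, ?_⟩
    refine LinearEquiv.ext fun v => funext fun i => ?_
    simp
  mul_mem' := by
    rintro _ _ ⟨a, ha, σ, rfl⟩ ⟨b, hb, τ, rfl⟩
    obtain ⟨c, hc, hcb⟩ := permMat_conj_mem hcomm σ hb
    refine ⟨a * c, mul_mem ha hc, σ * τ, ?_⟩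
    rw [← permMat_mul, mul_assoc, ← mul_assoc (permMat σ), hcb]
    simp only [mul_assoc]
  inv_mem' := by
    rintro _ ⟨a, ha, σ, rfl⟩
    obtain ⟨c, hc, hca⟩ := permMat_conj_mem hcomm σ⁻¹ (inv_mem ha)
    refine ⟨c, hc, σ⁻¹, ?_⟩
    rw [← hca, mul_inv_rev]
    rfl

end Imprimitive

/-! ### The Dowling lattice -/

section Dowling

/-- A representative of a partial `K`-partition of `{1, …, n}`: a set partition of a subset
`support` (whose complement is the zero block) into nonempty blocks, with a label in `K` at each
point of `support`. -/
structure PartialKPartition (n : ℕ) (K : Type*) where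
  support : Finset (Fin n)
  blocks : Finpartition support
  label : support → K

variable {n : ℕ} {K : Type*} [Group K]

/-- On the subset `B` (of both supports) the labels of `y` arise from those of `x` by multiplication
from the left with one element of `K`. -/
def PartialKPartition.SameLabels (x y : PartialKPartition n K) (B : Finset (Fin n)) : Prop :=
  ∃ g : K, ∀ l ∈ B, ∀ (hx : l ∈ x.support) (hy : l ∈ y.support),
    y.label ⟨l, hy⟩ = g * x.label ⟨l, hx⟩

/-- `x ≤ y` if every block of `y` is a union of blocks of `x`, on each of which the labels of `y`
and of `x` agree up to multiplication from the left with an element of `K`. -/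
instance : Preorder (PartialKPartition n K) where
  le x y := ∀ B' ∈ y.blocks.parts, ∃ S ⊆ x.blocks.parts, B' = S.biUnion id ∧
    ∀ B ∈ S, x.SameLabels y B
  le_refl x B hB := by
    refine ⟨{B}, by simpa using hB, by simp, ?_⟩
    exact fun _ _ => ⟨1, fun _ _ _ _ => by simp⟩
  le_trans x y z hxy hyz C hC := by
    classical
    obtain ⟨S, hS, rfl, hlab⟩ := hyz C hC
    choose! T hT hBT hTlab using hxy
    refine ⟨S.biUnion T, ?_, ?_, ?_⟩
    · exact Finset.biUnion_subset.2 fun B hB => hT B (hS hB)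
    · rw [Finset.biUnion_biUnion]
      exact Finset.biUnion_congr rfl fun B hB => hBT B (hS hB)
    · intro A hA
      obtain ⟨B, hB, hAB⟩ := Finset.mem_biUnion.1 hA
      obtain ⟨g, hg⟩ := hlab B hB
      obtain ⟨h, hh⟩ := hTlab B (hS hB) A hAB
      refine ⟨g * h, fun l hl hx hz => ?_⟩
      have hlB : l ∈ B := by
        rw [hBT B (hS hB)]
        exact Finset.mem_biUnion.2 ⟨A, hAB, hl⟩
      have hy : l ∈ y.support := y.blocks.le (hS hB) hlB
      rw [hg l hlB hy hz, hh l hl hx hy, mul_assoc]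

theorem PartialKPartition.le_def (x y : PartialKPartition n K) :
    x ≤ y ↔ ∀ B' ∈ y.blocks.parts, ∃ S ⊆ x.blocks.parts, B' = S.biUnion id ∧
      ∀ B ∈ S, x.SameLabels y B :=
  Iff.rfl

variable (n K) in
/-- The Dowling lattice of rank `n` of the group `K`: the partially ordered set of partial
`K`-partitions. Two representatives are identified if each is below the other; by
`PartialKPartition.antisymmRel_iff` this means that they have the same blocks (hence the same
support) and, on each block, labels that differ by left multiplication with an element of `K`. -/
abbrev DowlingLattice : Type _ :=
  Antisymmetrization (PartialKPartition n K) (· ≤ ·)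

theorem PartialKPartition.exists_block_subset {x y : PartialKPartition n K} (h : x ≤ y)
    {B' : Finset (Fin n)} (hB' : B' ∈ y.blocks.parts) {l : Fin n} (hl : l ∈ B') :
    ∃ B ∈ x.blocks.parts, l ∈ B ∧ B ⊆ B' ∧ x.SameLabels y B := by
  obtain ⟨S, hS, rfl, hlab⟩ := h B' hB'
  obtain ⟨B, hB, hlB⟩ := Finset.mem_biUnion.1 hl
  exact ⟨B, hS hB, hlB, Finset.subset_biUnion_of_mem id hB, hlab B hB⟩

theorem PartialKPartition.parts_subset_of_antisymm {x y : PartialKPartition n K} (hxy : x ≤ y)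
    (hyx : y ≤ x) : ∀ B ∈ y.blocks.parts, B ∈ x.blocks.parts ∧ x.SameLabels y B := by
  intro B hB
  obtain ⟨l, hl⟩ := y.blocks.nonempty_of_mem_parts hB
  obtain ⟨A, hA, hlA, hAB, hlab⟩ := exists_block_subset hxy hB hl
  obtain ⟨C, hC, hlC, hCA, -⟩ := exists_block_subset hyx hA hlA
  have hCB : C = B := y.blocks.eq_of_mem_parts hC hB hlC hl
  subst hCB
  have : A = C := hAB.antisymm hCA
  subst this
  exact ⟨hA, hlab⟩

theorem PartialKPartition.antisymmRel_iff (x y : PartialKPartition n K) :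
    AntisymmRel (· ≤ ·) x y ↔
      x.blocks.parts = y.blocks.parts ∧ ∀ B ∈ x.blocks.parts, x.SameLabels y B := by
  constructor
  · rintro ⟨hxy, hyx⟩
    have h1 := parts_subset_of_antisymm hxy hyx
    have h2 := parts_subset_of_antisymm hyx hxy
    exact ⟨Finset.Subset.antisymm (fun B hB => (h2 B hB).1) fun B hB => (h1 B hB).1,
      fun B hB => (h1 B (h2 B hB).1).2⟩
  · rintro ⟨h, hlab⟩
    constructor
    · intro B hB
      rw [← h] at hB
      exact ⟨{B}, by simpa using hB, by simp, by simpa using hlab B hB⟩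
    · intro B hB
      refine ⟨{B}, by simpa [← h] using hB, by simp, fun C hC => ?_⟩
      obtain rfl := Finset.mem_singleton.1 hC
      obtain ⟨g, hg⟩ := hlab C hB
      exact ⟨g⁻¹, fun l hl hy hx => by rw [hg l hl hx hy, inv_mul_cancel_left]⟩

end Dowling

end

end QuatRefl

/-!
Both posets are posets of subspaces of `V = ℍⁿ`. To a partial `K`-partition `x = (J, Π, ξ)` attach
the subspace `x.space` of all `v` with `v i = 0` for `i ∉ J` and `ξ l * v l = ξ m * v m` whenever
`l` and `m` lie in one block of `Π`.

* Inclusion of these subspaces is the reverse of the Dowling order (`space_le_space_iff`): the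
  vector with entries `(ξ l)⁻¹` on a block and zero elsewhere lies in `x.space`, and it recovers the
  block as well as the labels on it up to a common left factor.
* The subspaces `x.space` are exactly the solution spaces of systems of equations `v i = k * v j`
  with `k ∈ K` (`exists_space_eq_of_system`). The coordinates which do not vanish identically on
  such a solution space form `J`, and proportionality of coordinates by an element of `K` defines
  `Π` and `ξ`. Every fixed space of an element of `G_n(K, H)` is given by such a system, hence so
  is every intersection of fixed spaces.
* Conversely `x.space` is an intersection of reflection hyperplanes (`exists_space_eq_sInf`).
  The hyperplane `v i = 0` belongs to `diag(1, …, h, …, 1)` for any `1 ≠ h ∈ H`, and the hyperplane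
  `v i = k * v j` belongs to a transposition matrix with entries `k` and `k⁻¹`. The condition on the
  product of the entries holds because the product is trivial in the abelianization of `K`.

Therefore `x ↦ x.space` identifies the Dowling lattice with the intersection lattice. By the Galois
connection between subgroups and fixed spaces, `x ↦` (pointwise stabilizer of `x.space`) identifies
it with the poset of parabolic subgroups.
-/

namespace QuatRefl

noncomputable section

open scoped Quaternion

/-! ### Order isomorphisms from an antisymmetrization -/

/-- A surjective order-reflecting monotone map out of a preorder induces an order isomorphism
from its antisymmetrization. -/
theorem nonempty_antisymmetrization_orderIso {α β : Type*} [Preorder α] [PartialOrder β]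
    (f : α → β) (hle : ∀ x y, f x ≤ f y ↔ x ≤ y) (hf : Function.Surjective f) :
    Nonempty (Antisymmetrization α (· ≤ ·) ≃o β) := by
  let F : Antisymmetrization α (· ≤ ·) → β := Quotient.lift f fun x y h =>
    le_antisymm ((hle x y).2 h.1) ((hle y x).2 h.2)
  have hF : ∀ a b, F a ≤ F b ↔ a ≤ b := by
    intro a b
    induction a using Quotient.inductionOn
    induction b using Quotient.inductionOn
    exact hle _ _
  exact ⟨RelIso.ofSurjective (OrderEmbedding.ofMapLEIff F hF) fun b => by
    obtain ⟨a, rfl⟩ := hf b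
    exact ⟨toAntisymmetrization _ a, rfl⟩⟩

/-! ### The subspace of a partial partition -/

section Space

variable {n : ℕ} {K : Subgroup ℍ[ℝ]ˣ}

namespace PartialKPartition

/-- The subspace of all vectors that vanish outside the support of `x` and whose coordinates,
multiplied from the left with the labels of `x`, are constant on the blocks of `x`. Multiplying the
labels on a block from the left with an element of `K` does not change it. -/
def space (x : PartialKPartition n K) : Submodule ℍ[ℝ]ᵐᵒᵖ (Fin n → ℍ[ℝ]) where
  carrier := {v | (∀ i ∉ x.support, v i = 0) ∧ ∀ B ∈ x.blocks.parts, ∀ l m : x.support,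
    (l : Fin n) ∈ B → (m : Fin n) ∈ B → ((x.label l : ℍ[ℝ]ˣ) : ℍ[ℝ]) * v l =
      ((x.label m : ℍ[ℝ]ˣ) : ℍ[ℝ]) * v m}
  zero_mem' := by simp
  add_mem' := by
    rintro v w ⟨hv, hv'⟩ ⟨hw, hw'⟩
    refine ⟨fun i hi => by simp [hv i hi, hw i hi], fun B hB l m hl hm => ?_⟩
    simp [mul_add, hv' B hB l m hl hm, hw' B hB l m hl hm]
  smul_mem' := by
    rintro c v ⟨hv, hv'⟩
    refine ⟨fun i hi => by simp [hv i hi], fun B hB l m hl hm => ?_⟩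
    simp [← mul_assoc, hv' B hB l m hl hm]

theorem mem_space {x : PartialKPartition n K} {v : Fin n → ℍ[ℝ]} :
    v ∈ x.space ↔ (∀ i ∉ x.support, v i = 0) ∧ ∀ B ∈ x.blocks.parts, ∀ l m : x.support,
      (l : Fin n) ∈ B → (m : Fin n) ∈ B → ((x.label l : ℍ[ℝ]ˣ) : ℍ[ℝ]) * v l =
        ((x.label m : ℍ[ℝ]ˣ) : ℍ[ℝ]) * v m :=
  Iff.rfl

open Classical in
/-- The vector with entries `(ξ l)⁻¹` on the block `B`, where `ξ` is the labelling of `x`, and zero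
elsewhere. -/
def blockVector (x : PartialKPartition n K) (B : Finset (Fin n)) (l : Fin n) : ℍ[ℝ] :=
  if h : l ∈ B ∧ l ∈ x.support then (((x.label ⟨l, h.2⟩ : ℍ[ℝ]ˣ)⁻¹ : ℍ[ℝ]ˣ) : ℍ[ℝ]) else 0

theorem blockVector_of_mem {x : PartialKPartition n K} {B : Finset (Fin n)} {l : Fin n}
    (hl : l ∈ B) (hx : l ∈ x.support) :
    x.blockVector B l = (((x.label ⟨l, hx⟩ : ℍ[ℝ]ˣ)⁻¹ : ℍ[ℝ]ˣ) : ℍ[ℝ]) :=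
  dif_pos ⟨hl, hx⟩

theorem blockVector_ne_zero_iff {x : PartialKPartition n K} {B : Finset (Fin n)}
    (hB : B ∈ x.blocks.parts) {l : Fin n} : x.blockVector B l ≠ 0 ↔ l ∈ B := by
  by_cases hl : l ∈ B
  · simp [blockVector_of_mem hl (x.blocks.le hB hl), hl]
  · simp [blockVector, hl]

theorem blockVector_mem_space (x : PartialKPartition n K) {B : Finset (Fin n)}
    (hB : B ∈ x.blocks.parts) : x.blockVector B ∈ x.space := by
  refine mem_space.2 ⟨fun i hi => by simp [blockVector, hi], fun C hC l m hl hm => ?_⟩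
  by_cases h : C = B
  · subst h
    rw [blockVector_of_mem hl l.2, blockVector_of_mem hm m.2]
    simp
  · have aux : ∀ i ∈ C, x.blockVector B i = 0 := fun i hi => by
      by_contra hi'
      exact h (x.blocks.eq_of_mem_parts hC hB hi ((blockVector_ne_zero_iff hB).1 hi'))
    rw [aux l hl, aux m hm]
    simp

/-- Inclusion of the subspaces is the reverse of the order of partial `K`-partitions. -/
theorem space_le_space_iff (x y : PartialKPartition n K) : y.space ≤ x.space ↔ x ≤ y := by
  constructor
  · intro h B' hB'
    obtain ⟨h0, hlab⟩ := mem_space.1 (h (y.blockVector_mem_space hB'))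
    have hsupp : B' ⊆ x.support := fun l hl => by
      by_contra hl'
      exact (blockVector_ne_zero_iff hB').2 hl (h0 l hl')
    have hsub : ∀ B ∈ x.blocks.parts, ∀ l ∈ B, l ∈ B' → B ⊆ B' := by
      intro B hB l hl hl' m hm
      have h1 := hlab B hB ⟨l, x.blocks.le hB hl⟩ ⟨m, x.blocks.le hB hm⟩ hl hm
      refine (blockVector_ne_zero_iff hB').1 fun h2 => ?_
      rw [h2, mul_zero] at h1
      exact (blockVector_ne_zero_iff hB').2 hl' ((Units.mul_right_eq_zero _).1 h1)
    classical
    refine ⟨{B ∈ x.blocks.parts | B ⊆ B'}, Finset.filter_subset _ _, ?_, ?_⟩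
    · ext l
      simp only [Finset.mem_biUnion, Finset.mem_filter, id]
      constructor
      · intro hl
        obtain ⟨B, hB, hlB⟩ := x.blocks.exists_mem (hsupp hl)
        exact ⟨B, ⟨hB, hsub B hB l hlB hl⟩, hlB⟩
      · rintro ⟨B, ⟨-, hBB'⟩, hlB⟩
        exact hBB' hlB
    · intro B hB
      obtain ⟨hB, hBB'⟩ := Finset.mem_filter.1 hB
      obtain ⟨m, hm⟩ := x.blocks.nonempty_of_mem_parts hB
      have hmx := x.blocks.le hB hm
      have hmy := y.blocks.le hB' (hBB' hm)
      refine ⟨y.label ⟨m, hmy⟩ * (x.label ⟨m, hmx⟩)⁻¹, fun l hl hlx hly => ?_⟩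
      have h1 := hlab B hB ⟨l, hlx⟩ ⟨m, hmx⟩ hl hm
      rw [blockVector_of_mem (hBB' hl) hly, blockVector_of_mem (hBB' hm) hmy,
        ← Units.val_mul, ← Units.val_mul, Units.val_inj] at h1
      have h2 : x.label ⟨l, hlx⟩ * (y.label ⟨l, hly⟩)⁻¹ =
          x.label ⟨m, hmx⟩ * (y.label ⟨m, hmy⟩)⁻¹ := Subtype.ext h1
      have h3 := congrArg (·⁻¹) h2
      simp only [mul_inv_rev, inv_inv] at h3
      rw [← h3, inv_mul_cancel_right]
  · intro h v hv
    obtain ⟨h0, hlab⟩ := mem_space.1 hv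
    refine mem_space.2 ⟨fun i hi => h0 i fun hi' => ?_, fun B hB l m hl hm => ?_⟩
    · obtain ⟨B', hB', hiB'⟩ := y.blocks.exists_mem hi'
      obtain ⟨B, hB, hiB, -, -⟩ := exists_block_subset h hB' hiB'
      exact hi (x.blocks.le hB hiB)
    · -- A block of `x` is either contained in a block of `y` or disjoint from the support of `y`.
      by_cases hy : ∃ i ∈ B, i ∈ y.support
      · obtain ⟨i, hiB, hiy⟩ := hy
        obtain ⟨B', hB', hiB'⟩ := y.blocks.exists_mem hiy
        obtain ⟨C, hC, hiC, hCB', g, hg⟩ := exists_block_subset h hB' hiB'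
        obtain rfl := x.blocks.eq_of_mem_parts hC hB hiC hiB
        have hly := y.blocks.le hB' (hCB' hl)
        have hmy := y.blocks.le hB' (hCB' hm)
        have h1 := hlab B' hB' ⟨l, hly⟩ ⟨m, hmy⟩ (hCB' hl) (hCB' hm)
        rw [hg l hl l.2 hly, hg m hm m.2 hmy] at h1
        simpa [mul_assoc] using h1
      · push Not at hy
        rw [h0 l (hy l hl), h0 m (hy m hm)]
        simp

open Classical in
/-- Every subspace defined by a system of equations `v i = k * v j` with `k ∈ K` is the subspace
of a partial `K`-partition. -/
theorem exists_space_eq_of_system (E : Set (Fin n × Fin n × K))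
    (W : Submodule ℍ[ℝ]ᵐᵒᵖ (Fin n → ℍ[ℝ]))
    (hW : ∀ v, v ∈ W ↔ ∀ e ∈ E, v e.1 = ((e.2.2 : ℍ[ℝ]ˣ) : ℍ[ℝ]) * v e.2.1) :
    ∃ x : PartialKPartition n K, x.space = W := by
  let s : Setoid (Fin n) :=
    { r := fun i j => ∃ k : K, ∀ v ∈ W, v j = ((k : ℍ[ℝ]ˣ) : ℍ[ℝ]) * v i
      iseqv := by
        refine ⟨fun i => ⟨1, by simp⟩, ?_, ?_⟩
        · rintro i j ⟨k, hk⟩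
          exact ⟨k⁻¹, fun v hv => by simp [hk v hv]⟩
        · rintro i j l ⟨k, hk⟩ ⟨k', hk'⟩
          exact ⟨k' * k, fun v hv => by simp [hk v hv, hk' v hv, mul_assoc]⟩ }
  have hrep : ∀ i, ∃ k : K, ∀ v ∈ W,
      v (Quotient.out (Quotient.mk s i)) = ((k : ℍ[ℝ]ˣ) : ℍ[ℝ]) * v i :=
    fun i => s.symm (Quotient.mk_out (s := s) i)
  choose ξ hξ using hrep
  let J : Finset (Fin n) := {i | ∃ v ∈ W, v i ≠ 0}
  have hJ : ∀ i, i ∈ J ↔ ∃ v ∈ W, v i ≠ 0 := by simp [J]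
  have hlabel : ∀ i j, s i j → ∀ v ∈ W,
      ((ξ i : ℍ[ℝ]ˣ) : ℍ[ℝ]) * v i = ((ξ j : ℍ[ℝ]ˣ) : ℍ[ℝ]) * v j := by
    intro i j hij v hv
    have : Quotient.mk s i = Quotient.mk s j := Quotient.sound hij
    rw [← hξ i v hv, ← hξ j v hv, this]
  have hblock : ∀ B ∈ (Finpartition.ofSetSetoid s J).parts, ∀ i ∈ B, ∀ j,
      j ∈ B ↔ j ∈ J ∧ s i j := by
    intro B hB i hi j
    have h1 := (Finpartition.ofSetSetoid s J).part_eq_of_mem hB hi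
    have h2 : i ∈ J := (Finpartition.ofSetSetoid s J).le hB hi
    rw [← h1, Finpartition.mem_part_ofSetSetoid_iff_rel]
    simp [h2]
  refine ⟨⟨J, Finpartition.ofSetSetoid s J, fun i => ξ i⟩, le_antisymm ?_ ?_⟩
  · intro v hv
    obtain ⟨h0, hlab⟩ := mem_space.1 hv
    refine (hW v).2 ?_
    rintro ⟨i, j, k⟩ he
    have hk : ∀ w ∈ W, w i = ((k : ℍ[ℝ]ˣ) : ℍ[ℝ]) * w j := fun w hw => (hW w).1 hw _ he
    change v i = ((k : ℍ[ℝ]ˣ) : ℍ[ℝ]) * v j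
    by_cases hj : j ∈ J
    · obtain ⟨w, hw, hwj⟩ := (hJ j).1 hj
      have hi : i ∈ J := (hJ i).2 ⟨w, hw, by rw [hk w hw]; simpa using hwj⟩
      obtain ⟨B, hB, hjB⟩ := (Finpartition.ofSetSetoid s J).exists_mem hj
      have hji : s j i := ⟨k, hk⟩
      have hiB : i ∈ B := (hblock B hB j hjB i).2 ⟨hi, hji⟩
      -- A vector of `W` with nonzero `j`-th coordinate shows that the labels of `i` and `j`
      -- differ by the factor `k`.
      have h1 := hlabel j i hji w hw
      rw [hk w hw, ← mul_assoc] at h1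
      have h2 := mul_right_cancel₀ hwj h1
      have h3 := hlab B hB ⟨j, hj⟩ ⟨i, hi⟩ hjB hiB
      change ((ξ j : ℍ[ℝ]ˣ) : ℍ[ℝ]) * v j = ((ξ i : ℍ[ℝ]ˣ) : ℍ[ℝ]) * v i at h3
      rw [h2, mul_assoc, Units.mul_right_inj] at h3
      exact h3.symm
    · have hi : i ∉ J := by
        rw [hJ] at hj ⊢
        push Not at hj ⊢
        intro w hw
        rw [hk w hw, hj w hw, mul_zero]
      rw [h0 i hi, h0 j hj, mul_zero]
  · intro v hv
    refine mem_space.2 ⟨fun i hi => ?_, fun B hB l m hl hm => ?_⟩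
    · by_contra hvi
      exact hi ((hJ i).2 ⟨v, hv, hvi⟩)
    · exact hlabel l m ((hblock B hB l hl m).1 hm).2 v hv

end PartialKPartition

end Space

/-! ### Reflections in the imprimitive groups -/

section Reflections

variable {n : ℕ} {K H : Subgroup ℍ[ℝ]ˣ} {hcomm : ⁅K, K⁆ ≤ H}

theorem mem_fixedSpace {V : Type*} [AddCommGroup V] [Module ℍ[ℝ]ᵐᵒᵖ V]
    {g : V ≃ₗ[ℍ[ℝ]ᵐᵒᵖ] V} {v : V} : v ∈ fixedSpace g ↔ g v = v := by
  rw [fixedSpace, LinearMap.mem_ker, LinearMap.sub_apply, sub_eq_zero]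
  exact eq_comm

/-- If `v - g v` is always a multiple of one nonzero vector `u`, but not always zero, then `1 - g`
has rank one. -/
theorem isReflection_of_sub_eq {V : Type*} [AddCommGroup V] [Module ℍ[ℝ]ᵐᵒᵖ V]
    {g : V ≃ₗ[ℍ[ℝ]ᵐᵒᵖ] V} (hg : IsOfFinOrder g) (u : V) (φ : V → ℍ[ℝ]ᵐᵒᵖ)
    (hφ : ∀ v, v - g v = φ v • u) {w : V} (hw : g w ≠ w) : IsReflection g := by
  have hw' : φ w • u ≠ 0 := by
    rw [← hφ, sub_ne_zero]
    exact hw.symm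
  obtain ⟨hφw, hu⟩ := smul_ne_zero_iff.1 hw'
  refine ⟨hg, ?_⟩
  have : LinearMap.range (LinearMap.id - (g : V →ₗ[ℍ[ℝ]ᵐᵒᵖ] V)) = ℍ[ℝ]ᵐᵒᵖ ∙ u := by
    refine le_antisymm ?_ ?_
    · rintro _ ⟨v, rfl⟩
      exact Submodule.mem_span_singleton.2 ⟨φ v, (hφ v).symm⟩
    · rw [Submodule.span_singleton_le_iff_mem]
      refine ⟨(φ w)⁻¹ • w, ?_⟩
      rw [map_smul]
      change (φ w)⁻¹ • (w - g w) = u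
      rw [hφ, inv_smul_smul₀ hφw]
  rw [this]
  exact finrank_span_singleton hu

theorem diag_mul_permMat_mem {d : Fin n → K}
    (hd : ∏ i, Abelianization.of (d i) ∈ (H.subgroupOf K).map Abelianization.of)
    (σ : Equiv.Perm (Fin n)) :
    diag (fun i => (d i : ℍ[ℝ]ˣ)) * permMat σ ∈ imprimitiveGroup n K H hcomm :=
  ⟨_, ⟨d, (prod_mem_iff hcomm d).2 hd, rfl⟩, σ, rfl⟩

theorem prod_abelianization_mulSingle {ι G : Type*} [Fintype ι] [DecidableEq ι] [Group G]
    (i : ι) (k : G) :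
    ∏ j, Abelianization.of ((Pi.mulSingle i k : ι → G) j) = Abelianization.of k := by
  rw [Fintype.prod_eq_single i fun j hj => by rw [Pi.mulSingle_eq_of_ne hj, map_one],
    Pi.mulSingle_eq_same]

/-- The `i`-th coordinate hyperplane is the fixed space of the reflection `diag(1, …, h, …, 1)`,
where `1 ≠ h ∈ H`. -/
theorem coordinate_hyperplane_mem (hK : Finite K) (hHK : H ≤ K) (hH : H ≠ ⊥) (i : Fin n) :
    ∃ X ∈ reflectionArrangement (imprimitiveGroup n K H hcomm), ∀ v, v ∈ X ↔ v i = 0 := by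
  obtain ⟨⟨h, hhH⟩, hh1⟩ := Subgroup.ne_bot_iff_exists_ne_one.1 hH
  replace hh1 : h ≠ 1 := fun h1 => hh1 (Subtype.ext h1)
  let k : K := ⟨h, hHK hhH⟩
  -- As a homomorphism from the finite group `K`, `k ↦ diag(1, …, k, …, 1)` has values of finite
  -- order.
  let D : (Fin n → ℍ[ℝ]ˣ) →* ((Fin n → ℍ[ℝ]) ≃ₗ[ℍ[ℝ]ᵐᵒᵖ] (Fin n → ℍ[ℝ])) :=
    { toFun := diag
      map_one' := LinearEquiv.ext fun v => funext fun j => by simp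
      map_mul' := fun d e => (diag_mul d e).symm }
  let F : K →* ((Fin n → ℍ[ℝ]) ≃ₗ[ℍ[ℝ]ᵐᵒᵖ] (Fin n → ℍ[ℝ])) :=
    D.comp ((MonoidHom.mulSingle (fun _ : Fin n => ℍ[ℝ]ˣ) i).comp K.subtype)
  have hFi : ∀ v, F k v i = h * v i := fun v => by simp [F, D, k]
  have hFj : ∀ v j, j ≠ i → F k v j = v j := fun v j hj => by simp [F, D, hj]
  have hfix : ∀ v, F k v = v ↔ v i = 0 := by
    intro v
    constructor
    · intro hv
      have h1 := congrFun hv i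
      rw [hFi] at h1
      by_contra h2
      exact hh1 (Units.ext (mul_right_cancel₀ h2 (h1.trans (one_mul _).symm)))
    · intro hv
      funext j
      by_cases hj : j = i
      · subst hj
        rw [hFi, hv, mul_zero]
      · exact hFj v j hj
  have hmem : F k ∈ imprimitiveGroup n K H hcomm := by
    have : F k = diag (fun j => ((Pi.mulSingle i k : Fin n → K) j : ℍ[ℝ]ˣ)) * permMat 1 := by
      refine LinearEquiv.ext fun v => funext fun j => ?_
      by_cases hj : j = i
      · subst hj
        simp [hFi, k]
      · simp [hFj v j hj, hj]
    rw [this]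
    refine diag_mul_permMat_mem ?_ 1
    rw [prod_abelianization_mulSingle]
    exact ⟨k, hhH, rfl⟩
  refine ⟨fixedSpace (F k), ⟨F k, hmem, ?_, rfl⟩, fun v => mem_fixedSpace.trans (hfix v)⟩
  refine isReflection_of_sub_eq (F.isOfFinOrder (isOfFinOrder_of_finite k))
    (Pi.single i 1) (fun v => MulOpposite.op (v i - h * v i)) (fun v => funext fun j => ?_)
    (w := Pi.single i 1) ?_
  · by_cases hj : j = i
    · subst hj
      simp [hFi]
    · simp [hFj v j hj, hj]
  · rw [Ne, hfix]
    simp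

/-- For `i ≠ j`, the hyperplane `v i = k * v j` is the fixed space of the transposition matrix with
entries `k` and `k⁻¹`. -/
theorem binomial_hyperplane_mem {i j : Fin n} (hij : i ≠ j) (k : K) :
    ∃ X ∈ reflectionArrangement (imprimitiveGroup n K H hcomm),
      ∀ v, v ∈ X ↔ v i = ((k : ℍ[ℝ]ˣ) : ℍ[ℝ]) * v j := by
  let d : Fin n → K := Pi.mulSingle i k * Pi.mulSingle j k⁻¹
  let g := diag (fun l => (d l : ℍ[ℝ]ˣ)) * permMat (Equiv.swap i j)
  have hgi : ∀ v, g v i = ((k : ℍ[ℝ]ˣ) : ℍ[ℝ]) * v j := fun v => by simp [g, d, hij]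
  have hgj : ∀ v, g v j = (((k : ℍ[ℝ]ˣ)⁻¹ : ℍ[ℝ]ˣ) : ℍ[ℝ]) * v i := fun v => by
    simp [g, d, hij.symm]
  have hgl : ∀ v l, l ≠ i → l ≠ j → g v l = v l := fun v l hi hj => by
    simp [g, d, hi, hj, Equiv.swap_apply_of_ne_of_ne]
  have hfix : ∀ v, g v = v ↔ v i = ((k : ℍ[ℝ]ˣ) : ℍ[ℝ]) * v j := by
    intro v
    constructor
    · intro hv
      rw [← hgi, hv]
    · intro hv
      funext l
      by_cases hi : l = i
      · rw [hi, hgi, hv]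
      by_cases hj : l = j
      · rw [hj, hgj, hv, Units.inv_mul_cancel_left]
      exact hgl v l hi hj
  have hmem : g ∈ imprimitiveGroup n K H hcomm := by
    refine diag_mul_permMat_mem ?_ _
    have : ∏ l, Abelianization.of (d l) = 1 := by
      simp only [d, Pi.mul_apply, map_mul, Finset.prod_mul_distrib]
      rw [prod_abelianization_mulSingle, prod_abelianization_mulSingle,
        ← map_mul, mul_inv_cancel, map_one]
    rw [this]
    exact one_mem _
  have hsq : g ^ 2 = 1 := by
    refine LinearEquiv.ext fun v => funext fun l => ?_
    rw [pow_two]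
    change g (g v) l = v l
    by_cases hi : l = i
    · rw [hi, hgi, hgj, Units.mul_inv_cancel_left]
    by_cases hj : l = j
    · rw [hj, hgj, hgi, Units.inv_mul_cancel_left]
    rw [hgl _ l hi hj, hgl _ l hi hj]
  refine ⟨fixedSpace g, ⟨g, hmem, ?_, rfl⟩, fun v => mem_fixedSpace.trans (hfix v)⟩
  refine isReflection_of_sub_eq (isOfFinOrder_iff_pow_eq_one.2 ⟨2, two_pos, hsq⟩)
    (Pi.single i 1 - Pi.single j (((k : ℍ[ℝ]ˣ)⁻¹ : ℍ[ℝ]ˣ) : ℍ[ℝ]))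
    (fun v => MulOpposite.op (v i - ((k : ℍ[ℝ]ˣ) : ℍ[ℝ]) * v j)) (fun v => funext fun l => ?_)
    (w := Pi.single i 1) ?_
  · by_cases hi : l = i
    · subst hi
      simp [hgi, hij]
    by_cases hj : l = j
    · subst hj
      simp [hgj, hij.symm, mul_sub, -Units.val_inv_eq_inv_val]
    simp [hgl v l hi hj, hi, hj]
  · rw [Ne, hfix]
    simp [hij.symm]

/-- The subspace of a partial `K`-partition is an intersection of reflection hyperplanes. -/
theorem exists_space_eq_sInf (hK : Finite K) (hHK : H ≤ K) (hH : H ≠ ⊥)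
    (x : PartialKPartition n K) :
    ∃ S ⊆ reflectionArrangement (imprimitiveGroup n K H hcomm), x.space = sInf S := by
  refine ⟨{W | W ∈ reflectionArrangement (imprimitiveGroup n K H hcomm) ∧ x.space ≤ W},
    fun W hW => hW.1, le_antisymm (le_sInf fun W hW => hW.2) fun v hv => ?_⟩
  rw [Submodule.mem_sInf] at hv
  refine PartialKPartition.mem_space.2 ⟨fun i hi => ?_, fun B hB l m hl hm => ?_⟩
  · obtain ⟨X, hX, hXv⟩ := coordinate_hyperplane_mem (hcomm := hcomm) hK hHK hH i
    exact (hXv v).1 (hv X ⟨hX, fun w hw => (hXv w).2 (hw.1 i hi)⟩)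
  · by_cases hlm : l = m
    · rw [hlm]
    have hlm' : (l : Fin n) ≠ m := fun h => hlm (Subtype.ext h)
    obtain ⟨X, hX, hXv⟩ :=
      binomial_hyperplane_mem (hcomm := hcomm) hlm' ((x.label l)⁻¹ * x.label m)
    have key : ∀ w : Fin n → ℍ[ℝ],
        w ∈ X ↔ ((x.label l : ℍ[ℝ]ˣ) : ℍ[ℝ]) * w l = ((x.label m : ℍ[ℝ]ˣ) : ℍ[ℝ]) * w m := by
      intro w
      rw [hXv, Subgroup.coe_mul, Subgroup.coe_inv, Units.val_mul, mul_assoc,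
        Units.eq_inv_mul_iff_mul_eq]
    exact (key v).1 (hv X ⟨hX, fun w hw => (key w).2 (hw.2 B hB l m hl hm)⟩)

/-- An intersection of fixed spaces of elements of `G_n(K, H)` is the subspace of a partial
`K`-partition. -/
theorem exists_space_eq_of_fixed (T : Set ((Fin n → ℍ[ℝ]) ≃ₗ[ℍ[ℝ]ᵐᵒᵖ] (Fin n → ℍ[ℝ])))
    (hT : ∀ g ∈ T, g ∈ imprimitiveGroup n K H hcomm)
    (W : Submodule ℍ[ℝ]ᵐᵒᵖ (Fin n → ℍ[ℝ])) (hW : ∀ v, v ∈ W ↔ ∀ g ∈ T, g v = v) :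
    ∃ x : PartialKPartition n K, x.space = W := by
  refine PartialKPartition.exists_space_eq_of_system
    {e | ∃ (d : Fin n → K) (σ : Equiv.Perm (Fin n)) (i : Fin n),
      diag (fun l => (d l : ℍ[ℝ]ˣ)) * permMat σ ∈ T ∧ e = (i, σ⁻¹ i, d i)} W fun v => ?_
  rw [hW]
  constructor
  · rintro h _ ⟨d, σ, i, hg, rfl⟩
    exact (congrFun (h _ hg) i).symm
  · intro h g hg
    obtain ⟨_, ⟨d, -, rfl⟩, σ, rfl⟩ := hT g hg
    exact funext fun i => (h _ ⟨d, σ, i, hg, rfl⟩).symm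

end Reflections

/-! ### The two isomorphisms -/

section Isomorphisms

variable {n : ℕ} {K H : Subgroup ℍ[ℝ]ˣ} (hcomm : ⁅K, K⁆ ≤ H)

theorem nonempty_intersectionLattice_orderIso (hK : Finite K) (hHK : H ≤ K) (hH : H ≠ ⊥) :
    Nonempty (IntersectionLattice (reflectionArrangement (imprimitiveGroup n K H hcomm)) ≃o
      DowlingLattice n K) := by
  refine (nonempty_antisymmetrization_orderIso
    (β := IntersectionLattice (reflectionArrangement (imprimitiveGroup n K H hcomm)))
    (fun x : PartialKPartition n K => ⟨x.space, exists_space_eq_sInf hK hHK hH x⟩)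
    (fun x y => PartialKPartition.space_le_space_iff x y) (fun X => ?_)).map OrderIso.symm
  obtain ⟨S, hS, hX⟩ := X.exists_eq_sInf
  obtain ⟨x, hx⟩ := exists_space_eq_of_fixed (hcomm := hcomm)
    {g | g ∈ imprimitiveGroup n K H hcomm ∧ fixedSpace g ∈ S} (fun g hg => hg.1) X.space (by
      intro v
      rw [hX, Submodule.mem_sInf]
      constructor
      · exact fun h g hg => mem_fixedSpace.1 (h _ hg.2)
      · intro h W hWS
        obtain ⟨g, hg, -, rfl⟩ := hS hWS
        exact mem_fixedSpace.2 (h g ⟨hg, hWS⟩))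
  exact ⟨x, IntersectionLattice.ext hx⟩

/-- A vector fixed by the pointwise stabilizer of `x.space` lies in `x.space`, because the stabilizer
contains the reflections whose hyperplanes cut out `x.space`. -/
theorem mem_space_of_forall_fixingSubgroup (hK : Finite K) (hHK : H ≤ K) (hH : H ≠ ⊥)
    (x : PartialKPartition n K) {v : Fin n → ℍ[ℝ]}
    (hv : ∀ g ∈ fixingSubgroup (imprimitiveGroup n K H hcomm) (x.space : Set (Fin n → ℍ[ℝ])),
      g • v = v) : v ∈ x.space := by
  obtain ⟨S, hS, hx⟩ := exists_space_eq_sInf (hcomm := hcomm) hK hHK hH x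
  rw [hx, Submodule.mem_sInf]
  intro W hW
  obtain ⟨g, hg, -, rfl⟩ := hS hW
  refine mem_fixedSpace.2 (hv ⟨g, hg⟩ ((mem_fixingSubgroup_iff _).2 fun w hw => ?_))
  rw [hx] at hw
  exact mem_fixedSpace.1 (Submodule.mem_sInf.1 hw _ hW)

theorem nonempty_parabolicSubgroup_orderIso (hK : Finite K) (hHK : H ≤ K) (hH : H ≠ ⊥) :
    Nonempty (ParabolicSubgroup (imprimitiveGroup n K H hcomm) ≃o DowlingLattice n K) := by
  refine (nonempty_antisymmetrization_orderIso
    (β := ParabolicSubgroup (imprimitiveGroup n K H hcomm))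
    (fun x : PartialKPartition n K =>
      ⟨fixingSubgroup (imprimitiveGroup n K H hcomm) (x.space : Set (Fin n → ℍ[ℝ])), _, rfl⟩)
    (fun x y => ?_) ?_).map OrderIso.symm
  · rw [← PartialKPartition.space_le_space_iff, Subtype.mk_le_mk]
    constructor
    · intro h v hv
      refine mem_space_of_forall_fixingSubgroup hcomm hK hHK hH x fun g hg => ?_
      exact (mem_fixingSubgroup_iff _).1 (h hg) v hv
    · exact fun h => fixingSubgroup_antitone _ _ h
  · rintro ⟨_, S, rfl⟩
    let W : Submodule ℍ[ℝ]ᵐᵒᵖ (Fin n → ℍ[ℝ]) :=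
      ⨅ g ∈ fixingSubgroup (imprimitiveGroup n K H hcomm) S,
        fixedSpace (g : (Fin n → ℍ[ℝ]) ≃ₗ[ℍ[ℝ]ᵐᵒᵖ] (Fin n → ℍ[ℝ]))
    have hW : ∀ v, v ∈ W ↔
        ∀ g ∈ fixingSubgroup (imprimitiveGroup n K H hcomm) S, g • v = v := by
      intro v
      simp only [W, Submodule.mem_iInf, mem_fixedSpace]
      rfl
    obtain ⟨x, hx⟩ := exists_space_eq_of_fixed (hcomm := hcomm)
      (Subtype.val '' (fixingSubgroup (imprimitiveGroup n K H hcomm) S :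
        Set (imprimitiveGroup n K H hcomm)))
      (by rintro _ ⟨g, -, rfl⟩; exact g.2) W (fun v => by
        rw [hW, Set.forall_mem_image]
        rfl)
    refine ⟨x, Subtype.ext (le_antisymm ?_ fun g hg => ?_)⟩
    · refine fixingSubgroup_antitone _ _ fun v hv => ?_
      rw [hx]
      exact (hW v).2 fun g hg => (mem_fixingSubgroup_iff _).1 hg v hv
    · refine (mem_fixingSubgroup_iff _).2 fun v hv => ?_
      rw [hx] at hv
      exact (hW v).1 hv g hg

end Isomorphisms

end

end QuatRefl

open scoped Quaternion in
theorem mainTheorem10 (n : ℕ) (K H : Subgroup ℍ[ℝ]ˣ) (hK : Finite K) (hHK : H ≤ K)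
    (hcomm : ⁅K, K⁆ ≤ H) (hH : H ≠ ⊥) :
    Nonempty (QuatRefl.ParabolicSubgroup (QuatRefl.imprimitiveGroup n K H hcomm) ≃o
      QuatRefl.DowlingLattice n K) ∧
    ∃ e : QuatRefl.IntersectionLattice
        (QuatRefl.reflectionArrangement (QuatRefl.imprimitiveGroup n K H hcomm)) ≃o
          QuatRefl.DowlingLattice n K,
      ∀ X Y, IsLUB {e X, e Y} (e (X ⊔ Y)) ∧ IsGLB {e X, e Y} (e (X ⊓ Y)) := by
  refine ⟨QuatRefl.nonempty_parabolicSubgroup_orderIso hcomm hK hHK hH, ?_⟩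
  obtain ⟨e⟩ := QuatRefl.nonempty_intersectionLattice_orderIso (n := n) hcomm hK hHK hH
  refine ⟨e, fun X Y => ?_⟩
  rw [← Set.image_pair, e.isLUB_image', e.isGLB_image']
  exact ⟨isLUB_pair, isGLB_pair⟩
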